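/- Setting. Let $X\subseteq\mathbb R$ be finite, $d\ge 0$, and let $X^d\subseteq\mathbb R^d$ carry the Euclidean distance. Let $U$ be any set and $f:U^*\to X^d$ a function on databases (finite sequences) over $U$. A randomized algorithm $A$ on $U^n$ is $(\varepsilon,\delta)$-differentially private if $\Pr[A(S)\in T]\le e^{\varepsilon}\Pr[A(S')\in T]+\delta$ for all $S,S'\in U^n$ differing in at most one entry and all (measurable) sets $T$ of outputs. A randomized algorithm $M$ solves the 1-cluster problem $(X^d,k,t)$ with parameters $(\Delta,w)$ and error probability $\beta$ if for every $Y\in(X^d)^k$, with probability at least $1-\beta$, it outputs a center $c\in X^d$ and a radius $\rho\in\mathbb R$ such that the ball of radius $\rho$ around $c$ contains at least $t-\Delta$ of the points of $Y$ (counted with multiplicity) and $\rho\le w\cdot r_{\rm opt}$, where $r_{\rm opt}$ is the least radius of a ball with center in $X^d$ containing at least $t$ points of $Y$. For $S\in U^n$, a point $c\in X^d$ is an $(m,r,\alpha)$-stable point of $f$ on $S$ if $\Pr[\|f(S')-c\|_2\le r]\ge\alpha$, where $S'$ consists of $m$ iid uniform samples (with replacement) from the rows of $S$; $f$ is $(m,r,\alpha)$-stable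 on $S$ if such a $c$ exists. Algorithm SA. Let $n,m\ge 1$, $0<\alpha\le 1$, $0<\beta<1$, $k=\lfloor n/(9m)\rfloor$, and for each integer $t\ge 0$ let $M_t$ be a randomized algorithm that maps $(X^d)^k$ to $X^d\times\mathbb R$. On input $S\in U^n$, SA draws $k$ independent databases $D_1,\dots,D_k$, each consisting of $m$ iid uniform samples from the rows of $S$, sets $Y=(f(D_1),\dots,f(D_k))$, runs $M_t$ on $Y$ with $t=\lceil\alpha k/2\rceil$, and outputs the center $z$ that $M_t$ returns. Statement. There is a universal constant $C>0$ such that for all choices of the above data and all $0\le\varepsilon\le\alpha/72$, $0\le\delta\le\beta\varepsilon/3$: 1. (Privacy) If every $M_t$ is $(\varepsilon,\delta)$-differentially private, then SA is $(\varepsilon,\delta)$-differentially private. 2. (Utility) Let $t_{\min}\ge 0$ be an integer, $w\ge 0$ and $r$ real numbers, and $S\in U^n$. Suppose that for every integer $t$ with $t_{\min}\le t\le k$ the algorithm $M_t$ is $(\varepsilon,\delta)$-differentially private and solves the 1-cluster problem $(X^d,k,t)$ with parameters $(\Delta_t,w)$ and error probability $\beta/3$, for some $\Delta_t\le t/2$.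 If $f$ is $(m,r,\alpha)$-stable on $S$ and $$n\ \ge\ m\cdot C\left(\frac{t_{\min}}{\alpha}+\frac1{\alpha^2}\log\frac{12}{\beta}\right),$$ then with probability at least $1-\beta$ the output $z$ of SA on $S$ is an $(m,wr,\alpha/8)$-stable point of $f$ on $S$. -/

import Mathlib

open MeasureTheory

/-- The domain `X^d`: points of Euclidean `d`-space all of whose coordinates lie in the finite set
`X ⊆ ℝ`, with the Euclidean distance. -/
abbrev Grid (X : Finset ℝ) (d : ℕ) : Type :=
  {x : EuclideanSpace ℝ (Fin d) // ∀ i, x i ∈ X}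

/-- A randomized algorithm on databases of `n` rows from `U` with outputs in `Y`: it maps every
database to its output distribution. -/
abbrev RandAlg (U : Type*) (n : ℕ) (Y : Type*) [MeasurableSpace Y] :=
  (Fin n → U) → ProbabilityMeasure Y

/-- `S'` arises from `S` by replacing (at most) one entry. -/
def Neighboring {U : Type*} {n : ℕ} (S S' : Fin n → U) : Prop :=
  ∃ (i : Fin n) (x : U), S' = Function.update S i x

/-- `(ε, δ)`-differential privacy. -/
def IsDP {U : Type*} {n : ℕ} {Y : Type*} [MeasurableSpace Y]
    (ε δ : ℝ) (A : RandAlg U n Y) : Prop :=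
  ∀ S S' : Fin n → U, Neighboring S S' → ∀ T : Set Y, MeasurableSet T →
    (A S : Measure Y).real T ≤ Real.exp ε * (A S' : Measure Y).real T + δ

section OneCluster

variable {X : Finset ℝ} {d k : ℕ}

/-- The number of input points (with multiplicity) in the closed ball of radius `ρ` around `c`. -/
noncomputable def ballCount (Y : Fin k → Grid X d) (c : Grid X d) (ρ : ℝ) : ℕ :=
  Nat.card {i : Fin k // dist (Y i) c ≤ ρ}

/-- The radius of the smallest ball in `X^d` containing at least `t` input points. -/
noncomputable def rOpt (Y : Fin k → Grid X d) (t : ℕ) : ℝ :=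
  sInf {ρ : ℝ | 0 ≤ ρ ∧ ∃ c : Grid X d, t ≤ ballCount Y c ρ}

/-- `M` solves the 1-cluster problem `(X^d, k, t)` with parameters `(Δ, w)` and error
probability `β`; the output of `M` is a pair (center, radius). -/
def SolvesOneCluster (M : RandAlg (Grid X d) k (Grid X d × ℝ)) (t : ℕ) (Δ w β : ℝ) : Prop :=
  ∀ Y : Fin k → Grid X d,
    1 - β ≤ (M Y : Measure (Grid X d × ℝ)).real
      {p | (t : ℝ) - Δ ≤ ballCount Y p.1 p.2 ∧ p.2 ≤ w * rOpt Y t}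

end OneCluster

section SampleAggregate

variable {U : Type*} {X : Finset ℝ} {d n : ℕ}

/-- The law of `m` independent uniform row indices of a database with `n ≥ 1` rows. -/
noncomputable def iidIndices (n m : ℕ) [NeZero n] : Measure (Fin m → Fin n) :=
  Measure.pi fun _ => (PMF.uniformOfFintype (Fin n)).toMeasure

instance (n m : ℕ) [NeZero n] : IsProbabilityMeasure (iidIndices n m) := by
  unfold iidIndices; infer_instance

/-- The subsample of `S` with row indices `I`. -/
def subsample {m : ℕ} (S : Fin n → U) (I : Fin m → Fin n) : List U :=
  List.ofFn fun j => S (I j)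

/-- `c` is an `(m, r, α)`-stable point of `f` on `S`. -/
def IsStablePoint [NeZero n] (f : List U → Grid X d) (m : ℕ) (r α : ℝ) (S : Fin n → U)
    (c : Grid X d) : Prop :=
  α ≤ (iidIndices n m).real {I | dist (f (subsample S I)) c ≤ r}

/-- `f` is `(m, r, α)`-stable on `S`. -/
def IsStable [NeZero n] (f : List U → Grid X d) (m : ℕ) (r α : ℝ) (S : Fin n → U) : Prop :=
  ∃ c : Grid X d, IsStablePoint f m r α S c

/-- The number `k = n / (9 m)` of subsamples (rounded down). -/
def saBlocks (n m : ℕ) : ℕ := n / (9 * m)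

/-- The cluster size `t = α k / 2` (rounded up) with which the 1-cluster solver is called. -/
noncomputable def saTarget (α : ℝ) (k : ℕ) : ℕ := ⌈α * k / 2⌉₊

/-- The algorithm `SA`: draw `k` independent subsamples of `S`, each consisting of `m` iid rows,
apply `f` to each, run the 1-cluster solver `M` with parameter `t = α k / 2` on the results, and
output the center that it finds. `M t` is the solver run with cluster size `t`. -/
noncomputable def SA [NeZero n] (f : List U → Grid X d) (m : ℕ) (α : ℝ)
    (M : ℕ → RandAlg (Grid X d) (saBlocks n m) (Grid X d × ℝ)) : RandAlg U n (Grid X d) :=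
  fun S =>
    ⟨(Measure.pi fun _ : Fin (saBlocks n m) => iidIndices n m).bind fun I =>
        (M (saTarget α (saBlocks n m)) (fun j => f (subsample S (I j))) :
          Measure (Grid X d × ℝ)).map Prod.fst,
      isProbabilityMeasure_bind (Measurable.of_discrete).aemeasurable
        (Filter.Eventually.of_forall fun _ =>
          Measure.isProbabilityMeasure_map measurable_fst.aemeasurable)⟩

end SampleAggregate

/-! ### Differential privacy for test functions -/

/-! Privacy is a hybrid argument over the `k` blocks. A changed row enters a given block with
probability at most `q = m / n`, and `k * q ≤ 1/9`. Replacing one block costs a factor `1 + q * e^ε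
* (e^ε - 1)` and an additive `q * e^ε * δ` (`integral_le_of_eqOn_compl`). Over `k` blocks
(`integral_pi_le_of_step`) this compounds to at most `e^ε` and `δ`.

Utility is generalization for private algorithms, with the index tuples of the blocks as iid
samples. By a Chernoff bound (`measureReal_hits_lt_le`), about a stable point `c` the ball of radius
`r` usually catches `α * k / 2` of the values. Then `rOpt ≤ r`, and the solver returns a `z` whose
ball of radius `w * r` holds at least `α * k / 4` of them. If `z` were not stable, this ball would
have true probability below `α / 8`, at most half of its empirical frequency.
`IsDP.integral_overfit_le` shows that a private choice of `z` rarely overfits like this. All spaces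
of indices and centers are finite, so integrability and measurability are automatic. -/

/-- Among weights `h` in `[0, 1]`, the sum of `h * D` is largest for the indicator of `{D ≥ 0}`,
where it is the privacy inequality for one event. Hence `δ` is paid only once. -/
theorem IsDP.integral_le {U Y : Type*} {n : ℕ} [MeasurableSpace Y] [Finite Y]
    [MeasurableSingletonClass Y] {ε δ : ℝ} {A : RandAlg U n Y} (hA : IsDP ε δ A)
    {S S' : Fin n → U} (hS : Neighboring S S') {h : Y → ℝ} (h0 : ∀ y, 0 ≤ h y)
    (h1 : ∀ y, h y ≤ 1) :
    ∫ y, h y ∂(A S : Measure Y) ≤ Real.exp ε * ∫ y, h y ∂(A S' : Measure Y) + δ := by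
  classical
  cases nonempty_fintype Y
  have key := hA S S' hS
    {y | 0 ≤ (A S : Measure Y).real {y} - Real.exp ε * (A S' : Measure Y).real {y}}
    (Set.toFinite _).measurableSet
  set D : Y → ℝ := fun y => (A S : Measure Y).real {y} - Real.exp ε * (A S' : Measure Y).real {y}
  have hsum : ∀ μ : Measure Y, [IsProbabilityMeasure μ] →
      μ.real {y | 0 ≤ D y} = ∑ y with 0 ≤ D y, μ.real {y} := by
    intro μ _
    rw [sum_measureReal_singleton]
    simp
  have key' : ∑ y with 0 ≤ D y, D y ≤ δ := by
    change (A S : Measure Y).real {y | 0 ≤ D y} ≤ Real.exp ε * (A S' : Measure Y).real {y | 0 ≤ D y} + δ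
      at key
    rw [hsum, hsum] at key
    simp only [D, Finset.sum_sub_distrib, ← Finset.mul_sum] at key ⊢
    linarith
  have hle : ∑ y, h y * D y ≤ ∑ y with 0 ≤ D y, D y := by
    rw [Finset.sum_filter]
    refine Finset.sum_le_sum fun y _ => ?_
    split_ifs with hy
    · exact mul_le_of_le_one_left hy (h1 y)
    · exact mul_nonpos_of_nonneg_of_nonpos (h0 y) (not_le.1 hy).le
  rw [integral_fintype .of_finite, integral_fintype .of_finite]
  have : ∑ y, h y * D y = ∑ y, (A S : Measure Y).real {y} • h y
      - Real.exp ε * ∑ y, (A S' : Measure Y).real {y} • h y := by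
    rw [Finset.mul_sum, ← Finset.sum_sub_distrib]
    refine Finset.sum_congr rfl fun y _ => ?_
    simp only [D, smul_eq_mul]
    ring
  linarith

theorem IsDP.map {U Y Z : Type*} {n : ℕ} [MeasurableSpace Y] [MeasurableSpace Z] {ε δ : ℝ}
    {A : RandAlg U n Y} (hA : IsDP ε δ A) {g : Y → Z} (hg : Measurable g) :
    IsDP ε δ fun S => (A S).map hg.aemeasurable := by
  intro S S' hS T hT
  have := hA S S' hS (g ⁻¹' T) (hg hT)
  simpa [map_measureReal_apply hg hT] using this

theorem IsDP.comp {U V Y : Type*} {n : ℕ} [MeasurableSpace Y] {ε δ : ℝ}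
    {A : RandAlg U n Y} (hA : IsDP ε δ A) (h : V → U) : IsDP ε δ fun S => A (h ∘ S) := by
  rintro S _ ⟨i, x, rfl⟩ T hT
  exact hA _ _ ⟨i, h x, Function.comp_update ..⟩ T hT

/-! ### Finite product measures -/

section Pi

variable {Ω : Type*} [MeasurableSpace Ω] [Finite Ω] [MeasurableSingletonClass Ω]
  (ν : Measure Ω) [IsProbabilityMeasure ν]

theorem integral_pi_insertNth {k : ℕ} (j : Fin (k + 1)) (F : (Fin (k + 1) → Ω) → ℝ) :
    ∫ I, F I ∂Measure.pi (fun _ => ν) =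
      ∫ ω, ∫ I, F (j.insertNth ω I) ∂Measure.pi (fun _ => ν) ∂ν := by
  have h := (measurePreserving_piFinSuccAbove (fun _ : Fin (k + 1) => ν) j).symm
  rw [← h.integral_comp (MeasurableEquiv.measurableEmbedding _), integral_prod _ .of_finite]
  rfl

/-- The `j`-th sample and an independent fresh one are exchangeable. -/
theorem integral_pi_swap {k : ℕ} (j : Fin k) (F : (Fin k → Ω) → Ω → ℝ) :
    ∫ I, ∫ ω, F (Function.update I j ω) (I j) ∂ν ∂Measure.pi (fun _ => ν) =
      ∫ I, ∫ ω, F I ω ∂ν ∂Measure.pi (fun _ => ν) := by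
  cases k with
  | zero => exact j.elim0
  | succ k =>
    rw [integral_pi_insertNth ν j, integral_pi_insertNth ν j]
    simp only [Fin.update_insertNth, Fin.insertNth_apply_same]
    simp_rw [integral_integral_swap (μ := Measure.pi fun _ : Fin k => ν)
      (ν := ν) Integrable.of_finite]
    rw [integral_integral_swap .of_finite]

end Pi

/-! ### Replacing the blocks one at a time -/

section Hybrid

variable {Ω : Type*} [MeasurableSpace Ω] [Finite Ω] [MeasurableSingletonClass Ω]
  {ν : Measure Ω} [IsProbabilityMeasure ν] {Y : Type*}

/-- Changing a random variable on an event of probability at most `q` changes the expectation of a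
test function of sensitivity `(ε, δ)` by little. -/
theorem integral_le_of_eqOn_compl {h h' : Ω → Y} {E : Set Ω} {q ε δ : ℝ} (hε : 0 ≤ ε)
    (hδ : 0 ≤ δ) (hE : ∀ ω ∉ E, h ω = h' ω) (hq : ν.real E ≤ q) {g : Y → ℝ}
    (g0 : ∀ y, 0 ≤ g y) (hg : ∀ y y', g y ≤ Real.exp ε * g y' + δ) :
    ∫ ω, g (h ω) ∂ν ≤ (1 + q * (Real.exp ε * (Real.exp ε - 1))) * ∫ ω, g (h' ω) ∂ν
      + q * (Real.exp ε * δ) := by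
  set G := ∫ ω, g (h' ω) ∂ν
  have hG : 0 ≤ G := integral_nonneg fun ω => g0 _
  have he : 1 ≤ Real.exp ε := Real.one_le_exp hε
  have hEm : MeasurableSet E := E.toFinite.measurableSet
  -- Averaging the sensitivity bound over `y' = h' ω` controls `g` uniformly by its mean, so the
  -- loss on `E` is relative to `G`.
  have hbd : ∀ y, g y ≤ Real.exp ε * G + δ := by
    intro y
    have : ∫ _ω : Ω, g y ∂ν ≤ ∫ ω, (Real.exp ε * g (h' ω) + δ) ∂ν :=
      integral_mono .of_finite .of_finite fun ω => hg _ _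
    rw [integral_add .of_finite .of_finite, integral_const_mul] at this
    simpa using this
  set c := Real.exp ε * (Real.exp ε - 1) * G + Real.exp ε * δ
  have hc : 0 ≤ c := by
    have := sub_nonneg.2 he
    positivity
  have hpt : ∀ ω, g (h ω) ≤ g (h' ω) + E.indicator (fun _ => c) ω := by
    intro ω
    by_cases hω : ω ∈ E
    · rw [Set.indicator_of_mem hω]
      have h1 := hg (h ω) (h' ω)
      have h2 := mul_le_mul_of_nonneg_left (hbd (h' ω)) (sub_nonneg.2 he)
      simp only [c]
      nlinarith
    · simp [hω, hE ω hω]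
  have := integral_mono (μ := ν) .of_finite .of_finite hpt
  rw [integral_add .of_finite .of_finite, integral_indicator_const _ hEm, smul_eq_mul] at this
  have h3 := mul_le_mul_of_nonneg_right hq hc
  simp only [c, G] at this h3 ⊢
  linarith

/-- Induction on `k`: averaging `F` over the other coordinates preserves nonnegativity and
sensitivity, so `step` applies to the average as a function of the remaining coordinate. -/
theorem integral_pi_le_of_step {h h' : Ω → Y} {a b ε δ : ℝ} (ha : 1 ≤ a) (hb : 0 ≤ b)
    (step : ∀ g : Y → ℝ, (∀ y, 0 ≤ g y) → (∀ y y', g y ≤ Real.exp ε * g y' + δ) →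
      ∫ ω, g (h ω) ∂ν ≤ a * ∫ ω, g (h' ω) ∂ν + b) {k : ℕ} {F : (Fin k → Y) → ℝ}
    (F0 : ∀ v, 0 ≤ F v) (hF : ∀ v j y, F v ≤ Real.exp ε * F (Function.update v j y) + δ) :
    ∫ I, F (h ∘ I) ∂Measure.pi (fun _ => ν) ≤
      a ^ k * ∫ I, F (h' ∘ I) ∂Measure.pi (fun _ => ν) + k * a ^ k * b := by
  induction k with
  | zero =>
    have (I : Fin 0 → Ω) : h ∘ I = h' ∘ I := Subsingleton.elim _ _
    simp [this]
  | succ k ih =>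
    have ins : ∀ (u : Ω → Y) (ω : Ω) (I : Fin k → Ω),
        u ∘ (Fin.insertNth 0 ω I : Fin (k + 1) → Ω) = Fin.insertNth 0 (u ω) (u ∘ I) := by
      intro u ω I
      ext j
      refine Fin.cases ?_ (fun j => ?_) j <;> simp
    rw [integral_pi_insertNth ν 0, integral_pi_insertNth ν 0]
    simp only [ins]
    have h1 : ∀ ω, ∫ I, F (Fin.insertNth 0 (h ω) (h ∘ I)) ∂Measure.pi (fun _ => ν) ≤
        a ^ k * ∫ I, F (Fin.insertNth 0 (h ω) (h' ∘ I)) ∂Measure.pi (fun _ => ν)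
          + k * a ^ k * b := by
      intro ω
      refine ih (F := fun v => F (Fin.insertNth 0 (h ω) v)) (fun v => F0 _) fun v j y => ?_
      have := hF (Fin.insertNth 0 (h ω) v) (Fin.succ j) y
      simpa [Fin.insertNth_zero', ← Fin.cons_update] using this
    have h2 := step (fun y => ∫ I, F (Fin.insertNth 0 y (h' ∘ I)) ∂Measure.pi (fun _ => ν))
      (fun y => integral_nonneg fun I => F0 _) (fun y y' => by
        have : ∫ I, F (Fin.insertNth 0 y (h' ∘ I)) ∂Measure.pi (fun _ => ν) ≤
            ∫ I, (Real.exp ε * F (Fin.insertNth 0 y' (h' ∘ I)) + δ)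
              ∂Measure.pi (fun _ : Fin k => ν) :=
          integral_mono .of_finite .of_finite fun I => by
            simpa using hF (Fin.insertNth 0 y (h' ∘ I)) 0 y'
        rw [integral_add .of_finite .of_finite, integral_const_mul] at this
        simpa using this)
    have h3 := integral_mono (μ := ν) .of_finite .of_finite h1
    rw [integral_add .of_finite .of_finite, integral_const_mul] at h3
    simp only [integral_const, probReal_univ, smul_eq_mul, one_mul] at h3
    have h4 := mul_le_mul_of_nonneg_left h2 (pow_nonneg (zero_le_one.trans ha) k)
    have h5 : a ^ k * b ≤ a ^ (k + 1) * b :=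
      mul_le_mul_of_nonneg_right (pow_le_pow_right₀ ha k.le_succ) hb
    have h6 := mul_le_mul_of_nonneg_left h5 k.cast_nonneg
    push_cast
    rw [pow_succ] at *
    linarith

end Hybrid

/-! ### Privacy of `SA` -/

section Privacy

variable {U : Type*} {X : Finset ℝ} {d n : ℕ}

instance : Finite (Grid X d) := by
  refine Finite.of_injective (fun (x : Grid X d) (i : Fin d) => (⟨x.1 i, x.2 i⟩ : X)) ?_
  intro x y hxy
  ext i
  simpa using congrFun hxy i

theorem iidIndices_mem_le (n m : ℕ) [NeZero n] (i : Fin n) :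
    (iidIndices n m).real {I | ∃ j, I j = i} ≤ m / n := by
  have hj : ∀ j : Fin m, (iidIndices n m).real {I | I j = i} = 1 / n := by
    intro j
    have h := measurePreserving_eval
      (fun _ : Fin m => (PMF.uniformOfFintype (Fin n)).toMeasure) j
    have := h.measureReal_preimage (s := {i}) (measurableSet_singleton i).nullMeasurableSet
    rw [iidIndices]
    refine Eq.trans this ?_
    rw [measureReal_def, PMF.toMeasure_apply_singleton _ _ (measurableSet_singleton i)]
    simp
  have hset : {I : Fin m → Fin n | ∃ j, I j = i} = ⋃ j, {I | I j = i} := by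
    ext; simp
  rw [hset]
  refine (measureReal_iUnion_fintype_le _).trans ?_
  simp [hj, div_eq_mul_inv]

theorem SA_real [NeZero n] (f : List U → Grid X d) (m : ℕ) (α : ℝ)
    (M : ℕ → RandAlg (Grid X d) (saBlocks n m) (Grid X d × ℝ)) (S : Fin n → U)
    (T : Set (Grid X d)) :
    (SA f m α M S : Measure (Grid X d)).real T =
      ∫ I, ((M (saTarget α (saBlocks n m)) ((fun J => f (subsample S J)) ∘ I)).map
          measurable_fst.aemeasurable : Measure (Grid X d)).real T
        ∂Measure.pi fun _ => iidIndices n m := by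
  have hT : MeasurableSet T := T.toFinite.measurableSet
  rw [measureReal_def]
  simp only [SA, ProbabilityMeasure.coe_mk]
  rw [Measure.bind_apply hT Measurable.of_discrete.aemeasurable]
  rw [← integral_toReal (Measurable.of_discrete).aemeasurable
    (Filter.Eventually.of_forall fun I => measure_lt_top _ _)]
  rfl

theorem SA_isDP [NeZero n] {m : ℕ} {α ε δ : ℝ} (hε : 0 ≤ ε) (hε' : ε ≤ 1 / 72) (hδ : 0 ≤ δ)
    (f : List U → Grid X d) {M : ℕ → RandAlg (Grid X d) (saBlocks n m) (Grid X d × ℝ)}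
    (hM : IsDP ε δ (M (saTarget α (saBlocks n m)))) : IsDP ε δ (SA (n := n) f m α M) := by
  rintro S _ ⟨i, x, rfl⟩ T hT
  set h := fun J : Fin m → Fin n => f (subsample S J)
  set h' := fun J : Fin m → Fin n => f (subsample (Function.update S i x) J)
  have heq : ∀ J ∉ {J : Fin m → Fin n | ∃ j, J j = i}, h J = h' J := by
    intro J hJ
    simp only [Set.mem_ofPred_eq, not_exists] at hJ
    simp [h, h', subsample, Function.update_of_ne (hJ _)]
  have he : 1 ≤ Real.exp ε := Real.one_le_exp hε
  set q : ℝ := m / n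
  have hq0 : 0 ≤ q := by positivity
  -- The 9 in the definition of `saBlocks` is used here: on average at most 1/9 of a block sees the
  -- changed row.
  have hkq : saBlocks n m * q ≤ 1 / 9 := by
    have hn : (0 : ℝ) < n := Nat.cast_pos.2 (NeZero.pos n)
    have : saBlocks n m * (9 * m) ≤ n := Nat.div_mul_le_self n (9 * m)
    have : (saBlocks n m : ℝ) * (9 * m) ≤ n := by exact_mod_cast this
    simp only [q]
    rw [mul_div_assoc', div_le_iff₀ hn]
    linarith
  set e := Real.exp ε
  have hmain := integral_pi_le_of_step (ν := iidIndices n m) (h := h) (h' := h') (ε := ε) (δ := δ)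
    (a := 1 + q * (e * (e - 1))) (b := q * (e * δ)) (k := saBlocks n m)
    (by have := sub_nonneg.2 he; have : 0 ≤ q * (e * (e - 1)) := by positivity
        linarith) (by positivity)
    (fun g g0 hg => integral_le_of_eqOn_compl hε hδ heq (iidIndices_mem_le n m i) g0 hg)
    (F := fun v => ((M (saTarget α (saBlocks n m)) v).map measurable_fst.aemeasurable :
      Measure (Grid X d)).real T) (fun v => measureReal_nonneg)
    (fun v j y => (hM.map measurable_fst) v _ ⟨j, y, rfl⟩ T hT)
  rw [SA_real, SA_real]
  refine hmain.trans ?_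
  have he2 : e ≤ 1 + 1.02 * ε := by
    have := Real.exp_bound' (x := ε) hε (by linarith) (n := 2) two_pos
    simp [Finset.sum_range_succ] at this
    simp only [e]
    nlinarith
  have hpow : (1 + q * (e * (e - 1))) ^ saBlocks n m ≤ e := by
    have h1 : 1 + q * (e * (e - 1)) ≤ Real.exp (q * (e * (e - 1))) := by
      rw [add_comm]; exact Real.add_one_le_exp _
    refine (pow_le_pow_left₀ (by have := sub_nonneg.2 he; positivity) h1 _).trans ?_
    rw [← Real.exp_nat_mul]
    refine Real.exp_le_exp.2 ?_
    have h2 : e * (e - 1) ≤ 9 * ε := by nlinarith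
    have h3 : 0 ≤ e * (e - 1) := by have := sub_nonneg.2 he; positivity
    calc (saBlocks n m : ℝ) * (q * (e * (e - 1))) = (saBlocks n m * q) * (e * (e - 1)) := by ring
      _ ≤ 1 / 9 * (9 * ε) := mul_le_mul hkq h2 h3 (by norm_num)
      _ = ε := by ring
  refine add_le_add (mul_le_mul_of_nonneg_right hpow (integral_nonneg fun _ => measureReal_nonneg)) ?_
  have h5 : (saBlocks n m : ℝ) * (1 + q * (e * (e - 1))) ^ saBlocks n m * (q * (e * δ)) ≤ (1 / 9) * e * (e * δ) := by
    calc _ = (saBlocks n m * q) * (1 + q * (e * (e - 1))) ^ saBlocks n m * (e * δ) := by ring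
      _ ≤ _ := by
        have := sub_nonneg.2 he
        gcongr
  refine h5.trans ?_
  have : 1 / 9 * e * e ≤ 1 := by nlinarith
  nlinarith

end Privacy

/-! ### Overfitting of private selections, and a lower-tail bound -/

section Generalization

variable {Ω : Type*} {k : ℕ}

/-- The number of entries of `I` that lie in `P`. -/
noncomputable def hits (P : Set Ω) (I : Fin k → Ω) : ℝ := ∑ j, P.indicator 1 (I j)

theorem hits_nonneg (P : Set Ω) (I : Fin k → Ω) : 0 ≤ hits P I :=
  Finset.sum_nonneg fun _ _ => Set.indicator_nonneg (fun _ _ => zero_le_one) _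

theorem hits_update_le (P : Set Ω) (I : Fin k → Ω) (j : Fin k) (ω : Ω) :
    hits P (Function.update I j ω) ≤ hits P I + 1 := by
  classical
  unfold hits
  rw [← Finset.add_sum_erase _ _ (Finset.mem_univ j), ← Finset.add_sum_erase _ (fun l =>
    P.indicator (1 : Ω → ℝ) (I l)) (Finset.mem_univ j)]
  have h1 : P.indicator (1 : Ω → ℝ) (Function.update I j ω j) ≤ 1 :=
    Set.indicator_le_self' (fun _ _ => zero_le_one) _
  have h2 : 0 ≤ P.indicator (1 : Ω → ℝ) (I j) := Set.indicator_nonneg (fun _ _ => zero_le_one) _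
  have h3 : ∑ l ∈ Finset.univ.erase j, P.indicator (1 : Ω → ℝ) (Function.update I j ω l) =
      ∑ l ∈ Finset.univ.erase j, P.indicator (1 : Ω → ℝ) (I l) :=
    Finset.sum_congr rfl fun l hl => by rw [Function.update_of_ne (Finset.ne_of_mem_erase hl)]
  linarith

variable [MeasurableSpace Ω] [Finite Ω] [MeasurableSingletonClass Ω]
  {ν : Measure Ω} [IsProbabilityMeasure ν] {G : Type*} [MeasurableSpace G] [Finite G]
  [MeasurableSingletonClass G]

/-- Replacing the `j`-th sample by a fresh one costs a private algorithm little. -/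
theorem IsDP.integral_indicator_le {ε δ R a : ℝ} {B : RandAlg Ω k G} (hB : IsDP ε δ B)
    (hR : 0 ≤ R) (P : G → Set Ω) {φ : (Fin k → Ω) → G → ℝ} (φ0 : ∀ I z, 0 ≤ φ I z)
    (φ1 : ∀ I z, φ I z ≤ 1) (φR : ∀ I j ω z, φ (Function.update I j ω) z ≤ R * φ I z)
    (φa : ∀ I z, φ I z * ν.real (P z) ≤ φ I z * a) (j : Fin k) :
    ∫ I, ∫ z, φ I z * (P z).indicator 1 (I j) ∂(B I : Measure G) ∂Measure.pi (fun _ => ν) ≤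
      Real.exp ε * R * a * ∫ I, ∫ z, φ I z ∂(B I : Measure G) ∂Measure.pi (fun _ => ν) + δ := by
  have i0 : ∀ z ω, 0 ≤ (P z).indicator (1 : Ω → ℝ) ω := fun z ω =>
    Set.indicator_nonneg (fun _ _ => zero_le_one) _
  have i1 : ∀ z ω, (P z).indicator (1 : Ω → ℝ) ω ≤ 1 := fun z ω =>
    Set.indicator_le_self' (fun _ _ => zero_le_one) _
  have hswap := integral_pi_swap ν j fun I _ =>
    ∫ z, φ I z * (P z).indicator 1 (I j) ∂(B I : Measure G)
  simp only [Function.update_self, integral_const, probReal_univ, one_smul] at hswap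
  -- Now `ω`, the tested point, occurs in the database of `B`. Privacy and `φR` move it out at the
  -- cost of `e^ε * R` and `δ`; then `ω` is independent of `z` and hits `P z` with probability `ν (P
  -- z)`.
  rw [← hswap]
  have hpt : ∀ I ω, ∫ z, φ (Function.update I j ω) z * (P z).indicator 1 ω
      ∂(B (Function.update I j ω) : Measure G) ≤
      Real.exp ε * ∫ z, R * φ I z * (P z).indicator 1 ω ∂(B I : Measure G) + δ := by
    intro I ω
    refine (hB.integral_le (S' := I) ⟨j, I j, by simp⟩ (fun z => mul_nonneg (φ0 _ _) (i0 _ _))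
      fun z => mul_le_one₀ (φ1 _ _) (i0 _ _) (i1 _ _)).trans ?_
    refine add_le_add (mul_le_mul_of_nonneg_left
      (integral_mono .of_finite .of_finite fun z => ?_) (Real.exp_pos ε).le) le_rfl
    exact mul_le_mul_of_nonneg_right (φR _ _ _ _) (i0 _ _)
  have hI : ∀ I, ∫ ω, ∫ z, φ (Function.update I j ω) z * (P z).indicator 1 ω
      ∂(B (Function.update I j ω) : Measure G) ∂ν ≤
      Real.exp ε * R * a * ∫ z, φ I z ∂(B I : Measure G) + δ := by
    intro I
    refine (integral_mono .of_finite .of_finite (hpt I)).trans ?_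
    rw [integral_add .of_finite .of_finite, integral_const_mul,
      integral_integral_swap .of_finite]
    simp only [integral_const, probReal_univ, one_smul, integral_const_mul]
    have hz : ∀ z, R * φ I z * ∫ ω, (P z).indicator 1 ω ∂ν ≤ R * a * φ I z := by
      intro z
      rw [integral_indicator_one (P z).toFinite.measurableSet]
      have := mul_le_mul_of_nonneg_left (φa I z) hR
      linarith
    have := integral_mono (μ := (B I : Measure G)) .of_finite .of_finite hz
    rw [integral_const_mul] at this
    have := mul_le_mul_of_nonneg_left this (Real.exp_pos ε).le
    linarith
  refine (integral_mono .of_finite .of_finite hI).trans ?_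
  rw [integral_add .of_finite .of_finite, integral_const_mul]
  simp

/-- A private algorithm rarely selects a set that is rich in samples but has small measure. -/
theorem IsDP.integral_overfit_le {ε δ η a τ lam : ℝ} {B : RandAlg Ω k G} (hB : IsDP ε δ B)
    (hk : 0 < k) (hη : 0 ≤ η) (hlam : 0 ≤ lam) (hgap : Real.exp ε * Real.exp η * a ≤ lam)
    (P : G → Set Ω) :
    (lam - Real.exp ε * Real.exp η * a) *
      ∫ I, (B I : Measure G).real {z | ν.real (P z) < a ∧ τ ≤ hits (P z) I}
        ∂Measure.pi (fun _ => ν) ≤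
      lam * Real.exp (-(η * (τ - lam * k))) + δ := by
  classical
  -- A soft version of the indicator of the overfit event: it dominates that indicator, but one
  -- changed sample alters it by a factor of at most `e^η`.
  set φ : (Fin k → Ω) → G → ℝ := fun I z =>
    if ν.real (P z) < a then min 1 (Real.exp (η * (hits (P z) I - τ))) else 0 with hφ
  have φ0 : ∀ I z, 0 ≤ φ I z := fun I z => by
    simp only [hφ]; split_ifs <;> positivity
  have φ1 : ∀ I z, φ I z ≤ 1 := fun I z => by
    simp only [hφ]; split_ifs <;> simp
  have φR : ∀ I j ω z, φ (Function.update I j ω) z ≤ Real.exp η * φ I z := by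
    intro I j ω z
    simp only [hφ]
    split_ifs
    · rw [mul_min_of_nonneg _ _ (Real.exp_pos η).le, ← Real.exp_add]
      refine min_le_min (by simpa using hη) (Real.exp_le_exp.2 ?_)
      have := mul_le_mul_of_nonneg_left (hits_update_le (P z) I j ω) hη
      linarith
    · simp
  have φa : ∀ I z, φ I z * ν.real (P z) ≤ φ I z * a := by
    intro I z
    by_cases h : ν.real (P z) < a
    · exact mul_le_mul_of_nonneg_left h.le (φ0 I z)
    · simp [hφ, h]
  set Φ := ∫ I, ∫ z, φ I z ∂(B I : Measure G) ∂Measure.pi (fun _ => ν)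
  -- The `φ`-weighted mean number of hits is computed in two ways: above, by resampling each
  -- coordinate; below, because `φ ≤ s` wherever there are fewer than `lam * k` hits.
  have hupper : ∫ I, ∫ z, φ I z * hits (P z) I ∂(B I : Measure G) ∂Measure.pi (fun _ => ν) ≤
      k * (Real.exp ε * Real.exp η * a * Φ + δ) := by
    have h := Finset.sum_le_sum fun j (_ : j ∈ Finset.univ) =>
      hB.integral_indicator_le (ν := ν) (Real.exp_pos η).le P φ0 φ1 φR φa j
    rw [← integral_finsetSum _ fun _ _ => .of_finite] at h
    simp_rw [← integral_finsetSum (μ := (B _ : Measure G)) Finset.univ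
      (fun _ _ => Integrable.of_finite), ← Finset.mul_sum] at h
    simpa [hits, Φ, mul_add] using h
  set s := Real.exp (-(η * (τ - lam * k)))
  have hlower : lam * k * (Φ - s) ≤
      ∫ I, ∫ z, φ I z * hits (P z) I ∂(B I : Measure G) ∂Measure.pi (fun _ => ν) := by
    have hpt : ∀ I z, lam * k * (φ I z - s) ≤ φ I z * hits (P z) I := by
      intro I z
      have hk0 : 0 ≤ lam * k := by positivity
      have hs : 0 < s := Real.exp_pos _
      rcases le_or_gt (lam * k) (hits (P z) I) with h | h
      · have := mul_le_mul_of_nonneg_left h (φ0 I z)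
        nlinarith
      · have h1 : φ I z ≤ s := by
          simp only [hφ]
          split_ifs
          · refine (min_le_right _ _).trans (Real.exp_le_exp.2 ?_)
            have := mul_le_mul_of_nonneg_left h.le hη
            linarith
          · exact hs.le
        exact (mul_nonpos_of_nonneg_of_nonpos hk0 (sub_nonpos.2 h1)).trans
          (mul_nonneg (φ0 _ _) (hits_nonneg _ _))
    have h2 := integral_mono (μ := Measure.pi fun _ => ν) .of_finite .of_finite fun I =>
      integral_mono (μ := (B I : Measure G)) .of_finite .of_finite (hpt I)
    have h3 : ∀ I, ∫ z, lam * k * (φ I z - s) ∂(B I : Measure G) =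
        lam * k * (∫ z, φ I z ∂(B I : Measure G) - s) := by
      intro I
      rw [integral_const_mul, integral_sub .of_finite .of_finite]
      simp
    simp only [h3] at h2
    rw [integral_const_mul, integral_sub .of_finite .of_finite] at h2
    simpa using h2
  have hp : ∫ I, (B I : Measure G).real {z | ν.real (P z) < a ∧ τ ≤ hits (P z) I}
      ∂Measure.pi (fun _ => ν) ≤ Φ := by
    refine integral_mono .of_finite .of_finite fun I => ?_
    dsimp only
    rw [← integral_indicator_one (Set.toFinite _).measurableSet]
    refine integral_mono .of_finite .of_finite fun z => ?_
    refine Set.indicator_le' (f := 1) (g := φ I) ?_ (fun _ _ => φ0 _ _) z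
    rintro z ⟨h1, h2⟩
    simp only [hφ, if_pos h1, Pi.one_apply]
    refine le_min le_rfl (Real.one_le_exp (mul_nonneg hη (sub_nonneg.2 h2)))
  have hk' : (0 : ℝ) < k := Nat.cast_pos.2 hk
  have h4 : lam * (Φ - s) ≤ Real.exp ε * Real.exp η * a * Φ + δ := by
    refine le_of_mul_le_mul_left ?_ hk'
    linarith [hlower.trans hupper]
  have := mul_le_mul_of_nonneg_left hp (sub_nonneg.2 hgap)
  linarith

/-- Chernoff's method with `exp (-hits)`: since `1 - 1/e ≥ 5/8`, the exponent is `1/2 - 5/8 = -1/8`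
times `α * k`. -/
theorem measureReal_hits_lt_le {P : Set Ω} {α : ℝ} (hα : α ≤ ν.real P) :
    (Measure.pi fun _ : Fin k => ν).real {I | hits P I < α * k / 2} ≤
      Real.exp (-(α * k / 8)) := by
  have hone : ∫ ω, Real.exp (-P.indicator 1 ω) ∂ν ≤ Real.exp (-(5 / 8 * α)) := by
    have h1 : ∀ ω, Real.exp (-P.indicator 1 ω) ≤ 1 - 5 / 8 * P.indicator 1 ω := by
      intro ω
      by_cases h : ω ∈ P
      · simp only [Set.indicator_of_mem h, Pi.one_apply]
        have := Real.exp_neg_one_lt_d9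
        linarith
      · simp [h]
    refine (integral_mono .of_finite .of_finite h1).trans ?_
    rw [integral_sub .of_finite .of_finite, integral_const_mul,
      integral_indicator_one P.toFinite.measurableSet]
    simp only [integral_const, probReal_univ, one_smul]
    have := Real.add_one_le_exp (-(5 / 8 * α))
    linarith
  have hprod : ∫ I, Real.exp (-hits P I) ∂Measure.pi (fun _ : Fin k => ν) ≤
      Real.exp (-(5 / 8 * α)) ^ k := by
    have : ∀ I : Fin k → Ω, Real.exp (-hits P I) = ∏ j, Real.exp (-P.indicator 1 (I j)) := by
      intro I
      rw [← Real.exp_sum, Finset.sum_neg_distrib, hits]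
    simp only [this]
    rw [integral_fintype_prod_eq_prod (fun _ ω => Real.exp (-P.indicator 1 ω))]
    simp only [Finset.prod_const, Finset.card_univ, Fintype.card_fin]
    exact pow_le_pow_left₀ (integral_nonneg fun _ => (Real.exp_pos _).le) hone k
  rw [← integral_indicator_one (Set.toFinite _).measurableSet]
  have hpt : ∀ I : Fin k → Ω, {I | hits P I < α * k / 2}.indicator (1 : (Fin k → Ω) → ℝ) I ≤
      Real.exp (α * k / 2) * Real.exp (-hits P I) := by
    intro I
    refine Set.indicator_le' (f := 1)
      (g := fun I : Fin k → Ω => Real.exp (α * k / 2) * Real.exp (-hits P I)) ?_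
      (fun _ _ => by positivity) I
    intro I hI
    rw [← Real.exp_add]
    refine Real.one_le_exp ?_
    have : hits P I < α * k / 2 := hI
    linarith
  refine (integral_mono .of_finite .of_finite hpt).trans ?_
  rw [integral_const_mul]
  refine (mul_le_mul_of_nonneg_left hprod (Real.exp_pos _).le).trans ?_
  rw [← Real.exp_nat_mul, ← Real.exp_add]
  refine Real.exp_le_exp.2 ?_
  linarith

end Generalization

/-! ### From the solver's guarantee to stable points -/

section Utility

variable {X : Finset ℝ} {d k : ℕ}

theorem ballCount_eq_hits {Ω : Type*} (h : Ω → Grid X d) (I : Fin k → Ω) (c : Grid X d) (ρ : ℝ) :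
    (ballCount (h ∘ I) c ρ : ℝ) = hits {ω | dist (h ω) c ≤ ρ} I := by
  classical
  simp [ballCount, hits, Set.indicator_apply, Nat.card_eq_fintype_card, Fintype.card_subtype]

theorem ballCount_mono (Y : Fin k → Grid X d) (c : Grid X d) {ρ ρ' : ℝ} (h : ρ ≤ ρ') :
    ballCount Y c ρ ≤ ballCount Y c ρ' := by
  unfold ballCount
  exact Nat.card_le_card_of_injective _ (Subtype.map_injective (f := id) (fun i hi => hi.trans h)
    Function.injective_id)

theorem rOpt_le {Y : Fin k → Grid X d} {t : ℕ} {c : Grid X d} {r : ℝ} (hr : 0 ≤ r)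
    (h : t ≤ ballCount Y c r) : rOpt Y t ≤ r :=
  csInf_le ⟨0, fun _ hρ => hρ.1⟩ ⟨hr, c, h⟩

theorem SolvesOneCluster.le_map_real {M : RandAlg (Grid X d) k (Grid X d × ℝ)} {t : ℕ}
    {Δ w β r : ℝ} (hM : SolvesOneCluster M t Δ w β) (hΔ : Δ ≤ t / 2) (hw : 0 ≤ w) (hr : 0 ≤ r)
    {Y : Fin k → Grid X d} {c : Grid X d} (hc : t ≤ ballCount Y c r) :
    1 - β ≤ ((M Y).map measurable_fst.aemeasurable : Measure (Grid X d)).real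
      {z | (t : ℝ) / 2 ≤ ballCount Y z (w * r)} := by
  refine (hM Y).trans ?_
  change _ ≤ ((M Y : Measure (Grid X d × ℝ)).map Prod.fst).real _
  rw [map_measureReal_apply measurable_fst (Set.toFinite _).measurableSet]
  refine measureReal_mono ?_
  rintro p ⟨h1, h2⟩
  have h3 : (ballCount Y p.1 p.2 : ℝ) ≤ ballCount Y p.1 (w * r) := by
    exact_mod_cast ballCount_mono Y p.1
      (h2.trans (mul_le_mul_of_nonneg_left (rOpt_le hr hc) hw))
  change (t : ℝ) / 2 ≤ ballCount Y p.1 (w * r)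
  linarith

variable {U : Type*} {n : ℕ}

theorem SA_utility [NeZero n] {m : ℕ} {α β ε δ : ℝ} (f : List U → Grid X d)
    (M : ℕ → RandAlg (Grid X d) (saBlocks n m) (Grid X d × ℝ)) (hα : 0 < α) (hβ : 0 < β)
    (hβ1 : β < 1) (hε' : ε ≤ 1 / 72) (hδ : δ ≤ α * β / 216) {Δ w r : ℝ} {S : Fin n → U}
    (hw : 0 ≤ w) (hk : 256 * Real.log (12 / β) ≤ α * saBlocks n m)
    (hM : IsDP ε δ (M (saTarget α (saBlocks n m))))
    (hΔ : Δ ≤ (saTarget α (saBlocks n m) : ℕ) / 2)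
    (hM' : SolvesOneCluster (M (saTarget α (saBlocks n m))) (saTarget α (saBlocks n m)) Δ w (β / 3))
    (hf : IsStable f m r α S) :
    1 - β ≤ (SA f m α M S : Measure (Grid X d)).real
      {z | IsStablePoint f m (w * r) (α / 8) S z} := by
  obtain ⟨c, hc⟩ := hf
  -- A ball of negative radius is empty, which contradicts `0 < α`.
  have hr : 0 ≤ r := by
    by_contra hr
    have : {I : Fin m → Fin n | dist (f (subsample S I)) c ≤ r} = ∅ :=
      Set.eq_empty_of_forall_notMem fun I hI => hr (dist_nonneg.trans hI)
    rw [IsStablePoint, this, measureReal_empty] at hc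
    linarith
  set h := fun J : Fin m → Fin n => f (subsample S J) with hh
  set t := saTarget α (saBlocks n m)
  set B : RandAlg (Fin m → Fin n) (saBlocks n m) (Grid X d) :=
    fun I => (M t (h ∘ I)).map measurable_fst.aemeasurable with hB
  set κ := (saBlocks n m : ℝ)
  have hlog : 0 < Real.log (12 / β) := Real.log_pos (by rw [lt_div_iff₀ hβ]; linarith)
  have hκ : 0 < κ := pos_of_mul_pos_right (by linarith : 0 < α * κ) hα.le
  set μ := Measure.pi fun _ : Fin (saBlocks n m) => iidIndices n m
  set P : Grid X d → Set (Fin m → Fin n) := fun z => {J | dist (h J) z ≤ w * r}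
  set bad : (Fin (saBlocks n m) → Fin m → Fin n) → Set (Grid X d) := fun I =>
    {z | (iidIndices n m).real (P z) < α / 8 ∧ α * κ / 4 ≤ hits (P z) I}
  have hexp : Real.exp (-(α * κ / 128)) ≤ (β / 12) ^ 2 := by
    have : Real.exp (-Real.log (12 / β)) = β / 12 := by
      rw [Real.exp_neg, Real.exp_log (by positivity), inv_div]
    rw [← this, ← Real.exp_nat_mul]
    refine Real.exp_le_exp.2 ?_
    push_cast
    linarith
  have hover : ∫ I, (B I : Measure (Grid X d)).real (bad I) ∂μ ≤ β / 3 := by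
    have he : Real.exp ε * Real.exp (1 / 8) ≤ 1.2 := by
      rw [← Real.exp_add]
      have h1 : Real.exp (ε + 1 / 8) ≤ Real.exp (5 / 36) := Real.exp_le_exp.2 (by linarith)
      have := Real.exp_bound' (x := 5 / 36) (by norm_num) (by norm_num) (n := 2) two_pos
      norm_num [Finset.sum_range_succ] at this
      linarith
    have hDP : IsDP ε δ B := (hM.map measurable_fst).comp h
    -- The threshold `lam = 3α/16` lies midway between the true frequency `α/8` and the empirical
    -- `α/4`. Since `e^(ε + 1/8) ≤ 1.2`, a gap of `0.0375 * α` remains, and the tail exponent is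
    -- `(1/8) * (1/4 - 3/16) = 1/128` times `α * κ`.
    have h1 := hDP.integral_overfit_le (ν := iidIndices n m) (η := 1 / 8) (a := α / 8)
      (τ := α * κ / 4) (lam := 3 / 16 * α) (Nat.cast_pos.1 hκ) (by norm_num) (by positivity)
      (by nlinarith) P
    have h2 : 0 ≤ ∫ I, (B I : Measure (Grid X d)).real (bad I) ∂μ :=
      integral_nonneg fun _ => measureReal_nonneg
    have h3 : -(1 / 8 * (α * κ / 4 - 3 / 16 * α * κ)) = -(α * κ / 128) := by ring
    rw [h3] at h1
    have h4 : 0.0375 * α ≤ 3 / 16 * α - Real.exp ε * Real.exp (1 / 8) * (α / 8) := by nlinarith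
    have h5 := (mul_le_mul_of_nonneg_right h4 h2).trans h1
    have h6 : 3 / 16 * α * Real.exp (-(α * κ / 128)) ≤ 3 / 16 * α * (β / 12) ^ 2 := by gcongr
    have h7 : 3 / 16 * α * (β / 12) ^ 2 ≤ 3 / 16 * α * (β / 144) := by
      gcongr
      nlinarith
    refine le_of_mul_le_mul_left ?_ (by positivity : 0 < 0.0375 * α)
    have : 0 < α * β := by positivity
    linarith
  set few : Set (Fin (saBlocks n m) → Fin m → Fin n) :=
    {I | hits {J | dist (h J) c ≤ r} I < α * κ / 2}
  have hfew : μ.real few ≤ β / 3 := by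
    refine (measureReal_hits_lt_le hc).trans ?_
    have : Real.exp (-(α * κ / 8)) ≤ Real.exp (-(α * κ / 128)) :=
      Real.exp_le_exp.2 (by have := mul_pos hα hκ; linarith)
    refine this.trans (hexp.trans ?_)
    nlinarith
  -- Three failures, each costing `β / 3`: the solver errs, too few values lie near `c`, or the
  -- chosen ball overfits.
  have hpt : ∀ I, 1 - β / 3 - few.indicator 1 I - (B I : Measure (Grid X d)).real (bad I) ≤
      (B I : Measure (Grid X d)).real {z | IsStablePoint f m (w * r) (α / 8) S z} := by
    intro I
    by_cases hI : I ∈ few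
    · have h1 : 0 ≤ (B I : Measure (Grid X d)).real (bad I) := measureReal_nonneg
      have h2 : 0 ≤ (B I : Measure (Grid X d)).real
        {z | IsStablePoint f m (w * r) (α / 8) S z} := measureReal_nonneg
      simp only [Set.indicator_of_mem hI, Pi.one_apply]
      linarith
    · have hI' : α * κ / 2 ≤ hits {J | dist (h J) c ≤ r} I := not_lt.1 hI
      rw [← ballCount_eq_hits] at hI'
      have h1 := hM'.le_map_real hΔ hw hr (Nat.ceil_le.2 hI')
      have h2 : {z | (t : ℝ) / 2 ≤ ballCount (h ∘ I) z (w * r)} ⊆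
          {z | IsStablePoint f m (w * r) (α / 8) S z} ∪ bad I := by
        intro z hz
        by_cases hs : IsStablePoint f m (w * r) (α / 8) S z
        · exact Or.inl hs
        · refine Or.inr ⟨not_le.1 hs, ?_⟩
          have h3 : α * κ / 2 ≤ t := Nat.le_ceil _
          have h4 : (t : ℝ) / 2 ≤ ballCount (h ∘ I) z (w * r) := hz
          rw [ballCount_eq_hits] at h4
          change _ ≤ hits {J | dist (h J) z ≤ w * r} I
          linarith
      have h3 := (measureReal_mono (μ := (B I : Measure (Grid X d))) h2).trans
        (measureReal_union_le _ _)
      simp only [Set.indicator_of_notMem hI]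
      linarith
  rw [SA_real]
  have := integral_mono (μ := μ) .of_finite .of_finite hpt
  rw [integral_sub .of_finite .of_finite, integral_sub .of_finite .of_finite,
    integral_indicator_one few.toFinite.measurableSet] at this
  simp only [integral_const, probReal_univ, one_smul] at this
  refine le_trans ?_ this
  linarith

end Utility

theorem mainTheorem7 :
    ∃ C : ℝ, 0 < C ∧
      ∀ (U : Type*) (X : Finset ℝ) (d n m : ℕ) [NeZero n] (α β ε δ : ℝ)
        (f : List U → Grid X d)
        (M : ℕ → RandAlg (Grid X d) (saBlocks n m) (Grid X d × ℝ)),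
        1 ≤ m → 0 < α → α ≤ 1 → 0 < β → β < 1 → 0 ≤ ε → 0 ≤ δ →
        ε ≤ α / 72 → δ ≤ β * ε / 3 →
        -- privacy of `SA`
        ((∀ t : ℕ, IsDP ε δ (M t)) → IsDP ε δ (SA (n := n) f m α M)) ∧
        -- utility of `SA`
        (∀ (tmin : ℕ) (Δ : ℕ → ℝ) (w r : ℝ) (S : Fin n → U), 0 ≤ w →
          (∀ t : ℕ, tmin ≤ t → t ≤ saBlocks n m →
            IsDP ε δ (M t) ∧ Δ t ≤ t / 2 ∧ SolvesOneCluster (M t) t (Δ t) w (β / 3)) →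
          IsStable f m r α S →
          (m : ℝ) * (C * (tmin / α + 1 / α ^ 2 * Real.log (12 / β))) ≤ n →
          1 - β ≤ (SA f m α M S : MeasureTheory.Measure (Grid X d)).real
            {z | IsStablePoint f m (w * r) (α / 8) S z}) := by
  -- `2700 = 9 * 300`: the 9 comes from `saBlocks`, and 300 leaves room for the required 256 and for
  -- the 1 lost in rounding down, as `log (12 / β) / α ≥ 1`.
  refine ⟨2700, by norm_num, ?_⟩
  intro U X d n m _ α β ε δ f M hm hα hα1 hβ hβ1 hε hδ hεα hδβ
  refine ⟨fun hM => SA_isDP hε (by linarith) hδ f (hM _), ?_⟩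
  intro tmin Δ w r S hw hM hf hn
  have hm0 : (0 : ℝ) < m := by exact_mod_cast hm
  set l := Real.log (12 / β)
  have hl : 1 ≤ l := by
    rw [Real.le_log_iff_exp_le (by positivity), le_div_iff₀ hβ]
    have := Real.exp_one_lt_d9
    nlinarith
  have hinv : 1 ≤ 1 / α := (one_le_div hα).2 hα1
  have hfloor : 300 * (tmin / α + 1 / α ^ 2 * l) < saBlocks n m + 1 := by
    have h1 : n < 9 * m * (n / (9 * m) + 1) := Nat.lt_mul_div_succ n (by positivity)
    have h2 : (n : ℝ) < 9 * m * (saBlocks n m + 1) := by exact_mod_cast h1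
    have h3 := hn.trans_lt h2
    refine lt_of_mul_lt_mul_left (a := 9 * (m : ℝ)) ?_ (by positivity)
    linarith
  have hl1 : 1 / α * l ≤ 1 / α ^ 2 * l := by
    have : 1 / α ^ 2 = 1 / α * (1 / α) := by ring
    rw [this]
    have : 1 / α ≤ 1 / α * (1 / α) := le_mul_of_one_le_left (by positivity) hinv
    exact mul_le_mul_of_nonneg_right this (by positivity)
  have hl2 : 1 ≤ 1 / α * l := one_le_mul_of_one_le_of_one_le hinv hl
  have hk1 : 256 * (1 / α * l) ≤ saBlocks n m := by
    have : 0 ≤ tmin / α := by positivity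
    linarith
  have hk2 : 2 * (tmin / α) ≤ saBlocks n m := by
    have : 0 ≤ tmin / α := by positivity
    linarith
  have hlow : tmin ≤ saTarget α (saBlocks n m) := by
    have h1 : (tmin : ℝ) ≤ α * saBlocks n m / 2 := by
      have := mul_le_mul_of_nonneg_left hk2 hα.le
      have h2 : α * (2 * (tmin / α)) = 2 * tmin := by field_simp
      linarith
    exact_mod_cast h1.trans (Nat.le_ceil _)
  have hhigh : saTarget α (saBlocks n m) ≤ saBlocks n m := by
    refine Nat.ceil_le.2 ?_
    have : (0 : ℝ) ≤ saBlocks n m := Nat.cast_nonneg _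
    nlinarith
  obtain ⟨h1, h2, h3⟩ := hM _ hlow hhigh
  refine SA_utility f M hα hβ hβ1 (by linarith) ?_ hw ?_ h1 h2 h3 hf
  · have := mul_le_mul_of_nonneg_left hεα hβ.le
    linarith
  · have := mul_le_mul_of_nonneg_left hk1 hα.le
    have h4 : α * (256 * (1 / α * l)) = 256 * l := by field_simp
    linarith
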